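/- Consider the continuous ski rental problem: renting costs $dt$ per $dt$ units of time, buying costs $1$, and skiing stops at an unknown time $x\in(0,1]$. A randomized algorithm is a probability distribution $\mu$ on $(0,1]$ for the purchase time. If the purchase time is $t$ and skiing stops at $x$, the competitive ratio is $\alpha(t,x)=(1+t)/x$ when $t\le x$ and $\alpha(t,x)=1$ when $t>x$. For an integer $\gamma\ge 2$ and a real $\delta>0$, $\mu$ is feasible if it satisfies the $(\gamma,\delta)$-tail constraint $$\Pr_{t\sim\mu}[\alpha(t,x)>\gamma]\le\delta\qquad\text{for all }x\in(0,1],$$ and a feasible $\mu$ is optimal if it minimizes the worst-case expected competitive ratio $\sup_{x\in(0,1]}\mathbb E_{t\sim\mu}[\alpha(t,x)]$ among all feasible distributions. For $j\ge 0$ put $$\ell_j=\frac1{\gamma-1}\Bigl(1-\frac1{\gamma^j}\Bigr),\qquad P_j=(\ell_j,\ell_{j+1}].$$ These intervals are consecutive, start at $\ell_0=0$, and accumulate at $1/(\gamma-1)$. **Theorem.** Let $\gamma\ge2$ be an integer and $\delta>0$. There is exactly one optimal distribution; it has a density $f\ge 0$ with respect to Lebesgue measure. Let $\lambda$ be its worst-case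 expected competitive ratio and let $$\hat t_j=\frac{1}{\gamma^j}\ln\Bigl(1+\frac{\delta}{\lambda-1}\Bigr).$$ The density $f$ can be chosen so that for every integer $j\ge0$ with $j<\frac1{2\gamma\delta}-1$ we have $0<\hat t_j<\ell_{j+1}-\ell_j$ and, for some constant $c_j>0$ (depending only on $\gamma,\delta,j$), - $f(t)=c_j\,e^{\gamma^j t}$ for all $t\in(\ell_j,\ell_j+\hat t_j]$, and - $f(t)=0$ for all $t\in(\ell_j+\hat t_j,\ell_{j+1}]$. In particular, if $\frac1{2\gamma\delta}-1>0$, then $f$ is neither nondecreasing nor nonincreasing on $(0,1]$. -/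

import Mathlib

open MeasureTheory Set

noncomputable section

/-- Competitive ratio in the continuous ski rental problem (renting costs `dt` per `dt` time,
buying costs `1`) when Alice buys at time `t` and skiing stops at time `x ∈ (0, 1]`.
The offline optimum pays `x`; Alice pays `x` if `x < t` and `t + 1` otherwise. -/
def skiRatio (t x : ℝ) : ℝ := if x < t then 1 else (1 + t) / x

/-- A randomized algorithm: a probability law on `(0, 1]` for the purchase time. -/
structure IsPurchaseDistribution (μ : Measure ℝ) : Prop where
  isProbabilityMeasure : IsProbabilityMeasure μ
  support : μ (Ioc (0 : ℝ) 1)ᶜ = 0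

/-- Expected competitive ratio when skiing stops at time `x`. -/
def expectedRatio (μ : Measure ℝ) (x : ℝ) : ENNReal :=
  ∫⁻ t, ENNReal.ofReal (skiRatio t x) ∂μ

/-- Expected competitive ratio against the worst stopping time `x ∈ (0, 1]`. -/
def competitiveRatio (μ : Measure ℝ) : ENNReal :=
  ⨆ x ∈ Ioc (0 : ℝ) 1, expectedRatio μ x

/-- The `(γ, δ)` tail constraint: whatever the stopping time, the competitive ratio
exceeds `γ` with probability at most `δ`. -/
def TailConstraint (γ δ : ℝ) (μ : Measure ℝ) : Prop :=
  ∀ x ∈ Ioc (0 : ℝ) 1, μ {t : ℝ | γ < skiRatio t x} ≤ ENNReal.ofReal δ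

/-- Feasible solutions of the problem with the single tail constraint `(γ, δ)`. -/
def IsFeasible (γ δ : ℝ) (μ : Measure ℝ) : Prop :=
  IsPurchaseDistribution μ ∧ TailConstraint γ δ μ

/-- Optimal solutions: feasible, with least worst-case expected competitive ratio. -/
def IsOptimalSolution (γ δ : ℝ) (μ : Measure ℝ) : Prop :=
  IsFeasible γ δ μ ∧ ∀ ν : Measure ℝ, IsFeasible γ δ ν → competitiveRatio μ ≤ competitiveRatio ν

/-- The measure with density `f` with respect to Lebesgue measure. -/
def densityLaw (f : ℝ → ℝ) : Measure ℝ :=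
  volume.withDensity fun t => ENNReal.ofReal (f t)

/-- The left end point `ℓ_j = (1 - γ^{-j}) / (γ - 1)` of the interval `P_j = (ℓ_j, ℓ_{j+1}]`. -/
def leftEnd (γ j : ℕ) : ℝ := 1 / ((γ : ℝ) - 1) * (1 - 1 / (γ : ℝ) ^ j)

end

/-! Everything is expressed through the distribution function `F` of the purchase time. The expected
ratio at `x` is `1 + (F x - ∫₀ˣ F) / x`. A worst-case ratio at most `1 + K` therefore means `F x ≤ K
x + ∫₀ˣ F`, and the tail constraint means `F x ≤ δ + F (γ x - 1)`. Both bound `F` from above by an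
expression increasing in `F`, so the functions satisfying them have a pointwise largest member,
which satisfies the bounds with equality (`maxSubsolution_eq_cdfBound`).

Let `K` be the least excess for which mass one is reachable. A scaling argument shows that the
largest `F` at this `K` has `F 1 = 1` (`optCdf_one`) and is tight at `x = 1`, that is `K + ∫₀¹ F =
1` (`optExcess_add_integral`). An optimal competitor has distribution function at most `F` and at
least the same integral, so it equals `F` (`IsOptimalSolution.eq_optStieltjes`).

The map `x ↦ γ x - 1` sends `P_(j+1)` onto `P_j` and `P_0` below zero. On `P_0` the equality reads
`F = min (K x + ∫₀ˣ F) δ`, solved by `min δ (K (eˣ - 1))`. While `(j + 1) δ < 1 / (2 γ)`, the bound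
`K ≥ 1/2` makes the tail term the active one, and `F` on `P_j` is a rescaled copy raised by `j δ`
(`optCdf_on_piece`). Local Lipschitz bounds and continuity at `1 / (γ - 1)` give absolute
continuity. -/

open Filter Topology ProbabilityTheory

/-! ### The monotone bound operator and its largest subsolution -/

/-- Projection of the real line onto `[0, 1]`. -/
def unitClamp (x : ℝ) : ℝ := max 0 (min x 1)

lemma unitClamp_nonneg (x : ℝ) : 0 ≤ unitClamp x := le_max_left _ _

lemma unitClamp_le_one (x : ℝ) : unitClamp x ≤ 1 := max_le zero_le_one (min_le_right _ _)

lemma unitClamp_mono : Monotone unitClamp := fun _ _ h =>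
  max_le_max le_rfl (min_le_min h le_rfl)

lemma unitClamp_of_nonpos {x : ℝ} (hx : x ≤ 0) : unitClamp x = 0 :=
  max_eq_left ((min_le_left _ _).trans hx)

lemma unitClamp_of_mem {x : ℝ} (h0 : 0 ≤ x) (h1 : x ≤ 1) : unitClamp x = x := by
  rw [unitClamp, min_eq_left h1, max_eq_right h0]

lemma unitClamp_of_one_le {x : ℝ} (hx : 1 ≤ x) : unitClamp x = 1 := by
  rw [unitClamp, min_eq_right hx, max_eq_right zero_le_one]

lemma unitClamp_sub_le {x y : ℝ} (h : x ≤ y) : unitClamp y - unitClamp x ≤ y - x := by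
  unfold unitClamp
  grind

/-- The bound on the value at `x` of a distribution function `G` on `(0, 1]` imposed by
total mass one, by the expected ratio being at most `1 + K`, and by the tail constraint. -/
noncomputable def cdfBound (γ : ℕ) (δ K : ℝ) (G : ℝ → ℝ) (x : ℝ) : ℝ :=
  min 1 (min (K * unitClamp x + ∫ s in (0 : ℝ)..unitClamp x, G s) (δ + G (γ * unitClamp x - 1)))

/-- Nonnegative monotone functions that obey their own `cdfBound`. -/
structure IsSubsolution (γ : ℕ) (δ K : ℝ) (G : ℝ → ℝ) : Prop where
  mono : Monotone G
  nonneg : ∀ x, 0 ≤ G x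
  le_bound : ∀ x, G x ≤ cdfBound γ δ K G x

section
variable {γ : ℕ} {δ K : ℝ} {G H : ℝ → ℝ}

lemma integral_mono_upper (hG : Monotone G) (h0 : ∀ x, 0 ≤ G x) {x y : ℝ} (hx : 0 ≤ x)
    (h : x ≤ y) : ∫ s in (0 : ℝ)..x, G s ≤ ∫ s in (0 : ℝ)..y, G s :=
  intervalIntegral.integral_mono_interval le_rfl hx h (Eventually.of_forall h0)
    hG.intervalIntegrable

lemma cdfBound_mono (hK : 0 ≤ K) (hG : Monotone G) (h0 : ∀ x, 0 ≤ G x) :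
    Monotone (cdfBound γ δ K G) := by
  intro x y h
  have h' := unitClamp_mono h
  refine min_le_min le_rfl (min_le_min (add_le_add ?_ ?_) ?_)
  · gcongr
  · exact integral_mono_upper hG h0 (unitClamp_nonneg _) h'
  · gcongr
    apply hG
    gcongr

lemma cdfBound_le_cdfBound (hG : Monotone G) (hH : Monotone H) (h : ∀ x, G x ≤ H x) (x : ℝ) :
    cdfBound γ δ K G x ≤ cdfBound γ δ K H x := by
  refine min_le_min le_rfl (min_le_min (add_le_add le_rfl ?_) ?_)
  · exact intervalIntegral.integral_mono_on (unitClamp_nonneg _) hG.intervalIntegrable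
      hH.intervalIntegrable fun s _ => h s
  · gcongr
    apply h

lemma cdfBound_nonneg (hδ : 0 < δ) (hK : 0 ≤ K) (h0 : ∀ x, 0 ≤ G x) (x : ℝ) :
    0 ≤ cdfBound γ δ K G x := by
  refine le_min zero_le_one (le_min ?_ ?_)
  · exact add_nonneg (mul_nonneg hK (unitClamp_nonneg _))
      (intervalIntegral.integral_nonneg (unitClamp_nonneg _) fun s _ => h0 s)
  · have := h0 (γ * unitClamp x - 1)
    linarith

lemma IsSubsolution.cdfBound (hG : IsSubsolution γ δ K G) (hδ : 0 < δ) (hK : 0 ≤ K) :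
    IsSubsolution γ δ K (cdfBound γ δ K G) where
  mono := cdfBound_mono hK hG.mono hG.nonneg
  nonneg := cdfBound_nonneg hδ hK hG.nonneg
  le_bound := cdfBound_le_cdfBound hG.mono (cdfBound_mono hK hG.mono hG.nonneg) hG.le_bound

lemma IsSubsolution.le_one (hG : IsSubsolution γ δ K G) (x : ℝ) : G x ≤ 1 :=
  (hG.le_bound x).trans (min_le_left _ _)

lemma IsSubsolution.le_ratio (hG : IsSubsolution γ δ K G) {x : ℝ} (h0 : 0 ≤ x) (h1 : x ≤ 1) :
    G x ≤ K * x + ∫ s in (0 : ℝ)..x, G s := by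
  have := (hG.le_bound x).trans ((min_le_right _ _).trans (min_le_left _ _))
  rwa [unitClamp_of_mem h0 h1] at this

lemma isSubsolution_zero (hδ : 0 < δ) (hK : 0 ≤ K) : IsSubsolution γ δ K 0 where
  mono := monotone_const
  nonneg _ := le_rfl
  le_bound x := cdfBound_nonneg hδ hK (fun _ => le_rfl) x

/-- Scaling multiplies the ratio bound exactly, while the constants `1` and `δ` only gain slack.
This trades total mass for a smaller excess. -/
lemma IsSubsolution.const_mul (hG : IsSubsolution γ δ K G) (hδ : 0 < δ) {θ : ℝ} (hθ : 0 ≤ θ)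
    (hθ1 : θ ≤ 1) : IsSubsolution γ δ (θ * K) (fun x => θ * G x) where
  mono := hG.mono.const_mul hθ
  nonneg x := mul_nonneg hθ (hG.nonneg x)
  le_bound x := by
    have h := mul_le_mul_of_nonneg_left (hG.le_bound x) hθ
    refine h.trans ?_
    unfold _root_.cdfBound
    rw [mul_min_of_nonneg _ _ hθ, mul_min_of_nonneg _ _ hθ]
    refine min_le_min (by linarith) (min_le_min ?_ ?_)
    · rw [intervalIntegral.integral_const_mul]
      linarith
    · nlinarith

/-- The largest subsolution. -/
noncomputable def maxSubsolution (γ : ℕ) (δ K : ℝ) (x : ℝ) : ℝ :=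
  sSup ((fun G : ℝ → ℝ => G x) '' {G | IsSubsolution γ δ K G})

lemma IsSubsolution.le_max (hG : IsSubsolution γ δ K G) (x : ℝ) : G x ≤ maxSubsolution γ δ K x :=
  le_csSup ⟨1, by rintro _ ⟨H, hH, rfl⟩; exact hH.le_one x⟩ ⟨G, hG, rfl⟩

lemma maxSubsolution_le (hδ : 0 < δ) (hK : 0 ≤ K) {x b : ℝ}
    (h : ∀ G, IsSubsolution γ δ K G → G x ≤ b) : maxSubsolution γ δ K x ≤ b :=
  csSup_le ⟨_, 0, isSubsolution_zero hδ hK, rfl⟩ (by rintro _ ⟨H, hH, rfl⟩; exact h H hH)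

lemma isSubsolution_max (hδ : 0 < δ) (hK : 0 ≤ K) :
    IsSubsolution γ δ K (maxSubsolution γ δ K) := by
  have hm : Monotone (maxSubsolution γ δ K) := fun x y h =>
    maxSubsolution_le hδ hK fun G hG => (hG.mono h).trans (hG.le_max y)
  exact ⟨hm, fun x => (isSubsolution_zero hδ hK).le_max x, fun x =>
    maxSubsolution_le hδ hK fun G hG =>
      (hG.le_bound x).trans (cdfBound_le_cdfBound hG.mono hm hG.le_max x)⟩

/-- Knaster–Tarski: the operator maps subsolutions to subsolutions, so its value at the largest one
cannot exceed it. -/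
lemma maxSubsolution_eq_cdfBound (hδ : 0 < δ) (hK : 0 ≤ K) (x : ℝ) :
    maxSubsolution γ δ K x = cdfBound γ δ K (maxSubsolution γ δ K) x :=
  le_antisymm ((isSubsolution_max hδ hK).le_bound x)
    (((isSubsolution_max hδ hK).cdfBound hδ hK).le_max x)

end

/-! ### Grönwall comparison and the lower bound on the excess -/

/-- An integral form of Grönwall's inequality with zero data on an interval of length at most
one. -/
lemma nonpos_of_le_integral {w : ℝ → ℝ} {a : ℝ} (ha0 : 0 ≤ a) (ha1 : a ≤ 1)
    (hw : IntervalIntegrable w volume 0 a) (h0 : ∀ x ∈ Icc 0 a, 0 ≤ w x)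
    (h : ∀ x ∈ Icc 0 a, w x ≤ ∫ s in (0 : ℝ)..x, w s) : ∀ x ∈ Icc 0 a, w x ≤ 0 := by
  set M := ∫ s in (0 : ℝ)..a, w s with hM
  have hsub : ∀ x ∈ Icc 0 a, IntervalIntegrable w volume 0 x := fun x hx =>
    hw.mono_set (by rw [uIcc_of_le hx.1, uIcc_of_le ha0]; exact Icc_subset_Icc_right hx.2)
  have h1 : ∀ x ∈ Icc 0 a, w x ≤ M := fun x hx => (h x hx).trans <| by
    have h2 : IntervalIntegrable w volume x a :=
      hw.mono_set (by rw [uIcc_of_le hx.2, uIcc_of_le ha0]; exact Icc_subset_Icc_left hx.1)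
    rw [hM, ← intervalIntegral.integral_add_adjacent_intervals (hsub x hx) h2]
    have := intervalIntegral.integral_nonneg (μ := volume) hx.2
      fun s hs => h0 s ⟨hx.1.trans hs.1, hs.2⟩
    linarith
  have h2 : ∀ x ∈ Icc 0 a, w x ≤ M * x := fun x hx => (h x hx).trans <| by
    have := intervalIntegral.integral_mono_on hx.1 (hsub x hx)
      (intervalIntegrable_const (c := M)) fun s hs => h1 s ⟨hs.1, hs.2.trans hx.2⟩
    rw [intervalIntegral.integral_const, smul_eq_mul] at this
    linarith
  have h3 : M ≤ M * (a ^ 2 / 2) := by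
    have := intervalIntegral.integral_mono_on ha0 hw
      (Continuous.intervalIntegrable (by fun_prop) 0 a : IntervalIntegrable (fun x => M * x) _ _ _) h2
    rw [intervalIntegral.integral_const_mul, integral_id] at this
    linarith
  have ha2 : a ^ 2 / 2 ≤ 1 / 2 := by nlinarith
  have hM0 : M ≤ 0 := by
    by_contra! hpos
    nlinarith
  exact fun x hx => (h1 x hx).trans hM0

lemma integral_exp_sub_one (K x : ℝ) :
    ∫ s in (0 : ℝ)..x, K * (Real.exp s - 1) = K * (Real.exp x - 1) - K * x := by
  rw [intervalIntegral.integral_const_mul, intervalIntegral.integral_sub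
    (Real.continuous_exp.intervalIntegrable _ _) intervalIntegrable_const]
  simp
  ring

/-- `K (eˣ - 1)` solves `y = K x + ∫₀ˣ y`; Grönwall is applied to the positive part of the
difference. -/
lemma IsSubsolution.le_exp {γ : ℕ} {δ K : ℝ} {G : ℝ → ℝ} (hG : IsSubsolution γ δ K G) :
    ∀ x ∈ Icc (0 : ℝ) 1, G x ≤ K * (Real.exp x - 1) := by
  have hi : ∀ a b, IntervalIntegrable (fun x => G x - K * (Real.exp x - 1)) volume a b :=
    fun a b => hG.mono.intervalIntegrable.sub (Continuous.intervalIntegrable (by fun_prop) _ _)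
  have hi' : ∀ a b, IntervalIntegrable (fun x => max 0 (G x - K * (Real.exp x - 1))) volume a b :=
    fun a b => ⟨(integrable_zero _ _ _).sup (hi a b).1, (integrable_zero _ _ _).sup (hi a b).2⟩
  have := nonpos_of_le_integral (w := fun x => max 0 (G x - K * (Real.exp x - 1))) zero_le_one
    le_rfl (hi' _ _) (fun x _ => le_max_left _ _) (fun x hx => ?_)
  · intro x hx
    have := (le_max_right _ _).trans (this x hx)
    linarith
  · refine max_le (intervalIntegral.integral_nonneg hx.1 fun _ _ => le_max_left _ _) ?_
    have h1 := hG.le_ratio hx.1 hx.2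
    have h2 := intervalIntegral.integral_mono_on hx.1 (hi 0 x) (hi' 0 x)
      fun s _ => le_max_right _ _
    rw [intervalIntegral.integral_sub hG.mono.intervalIntegrable
      (Continuous.intervalIntegrable (by fun_prop) _ _), integral_exp_sub_one] at h2
    linarith

lemma IsSubsolution.half_le {γ : ℕ} {δ K : ℝ} {G : ℝ → ℝ} (hG : IsSubsolution γ δ K G)
    (h1 : G 1 = 1) : 1 / 2 ≤ K := by
  have h := hG.le_exp 1 ⟨zero_le_one, le_rfl⟩
  have h3 := Real.exp_one_lt_d9
  have h4 := Real.exp_one_gt_d9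
  rw [h1] at h
  nlinarith

/-! ### The optimal excess: mass one and tightness at `x = 1` -/

/-- The least excess ratio for which a subsolution has total mass one. -/
noncomputable def optExcess (γ : ℕ) (δ : ℝ) : ℝ :=
  sInf {K | 0 ≤ K ∧ ∃ G, IsSubsolution γ δ K G ∧ G 1 = 1}

section
variable {γ : ℕ} {δ : ℝ}

lemma exists_subsolution_one (hγ : 2 ≤ γ) (hδ : 0 < δ) :
    ∃ G, IsSubsolution γ δ 1 G ∧ G 1 = 1 := by
  have h0 : ∀ x : ℝ, (0 : ℝ) ≤ if 1 ≤ x then 1 else 0 := fun x => by split_ifs <;> simp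
  refine ⟨fun x => if 1 ≤ x then 1 else 0, ⟨fun x y h => ?_, h0, fun x => ?_⟩, by simp⟩
  · grind
  -- The witness is the law that always buys at time `1`.
  · by_cases hx : 1 ≤ x
    · have hγ' : (2 : ℝ) ≤ γ := by exact_mod_cast hγ
      have : (1 : ℝ) ≤ γ * 1 - 1 := by linarith
      simp only [cdfBound, unitClamp_of_one_le hx, if_pos hx, if_pos this]
      refine le_min le_rfl (le_min ?_ (by linarith))
      have := intervalIntegral.integral_nonneg (μ := volume) zero_le_one fun s _ => h0 s
      linarith
    · simp only [if_neg hx]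
      exact cdfBound_nonneg hδ zero_le_one h0 x

lemma optExcess_le {K : ℝ} (hK : 0 ≤ K) {G : ℝ → ℝ} (hG : IsSubsolution γ δ K G) (h1 : G 1 = 1) :
    optExcess γ δ ≤ K :=
  csInf_le ⟨0, fun _ h => h.1⟩ ⟨hK, G, hG, h1⟩

lemma half_le_optExcess (hγ : 2 ≤ γ) (hδ : 0 < δ) : 1 / 2 ≤ optExcess γ δ :=
  le_csInf ⟨1, zero_le_one, exists_subsolution_one hγ hδ⟩ fun _ ⟨_, _, hG, h1⟩ => hG.half_le h1

lemma optExcess_pos (hγ : 2 ≤ γ) (hδ : 0 < δ) : 0 < optExcess γ δ :=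
  lt_of_lt_of_le (by norm_num) (half_le_optExcess hγ hδ)

/-- The distribution function of the optimal solution. -/
noncomputable def optCdf (γ : ℕ) (δ : ℝ) : ℝ → ℝ := maxSubsolution γ δ (optExcess γ δ)

lemma isSubsolution_optCdf (hγ : 2 ≤ γ) (hδ : 0 < δ) :
    IsSubsolution γ δ (optExcess γ δ) (optCdf γ δ) :=
  isSubsolution_max hδ (optExcess_pos hγ hδ).le

lemma optCdf_eq_cdfBound (hγ : 2 ≤ γ) (hδ : 0 < δ) (x : ℝ) :
    optCdf γ δ x = cdfBound γ δ (optExcess γ δ) (optCdf γ δ) x :=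
  maxSubsolution_eq_cdfBound hδ (optExcess_pos hγ hδ).le x

lemma optCdf_one (hγ : 2 ≤ γ) (hδ : 0 < δ) : optCdf γ δ 1 = 1 := by
  refine le_antisymm ((isSubsolution_optCdf hγ hδ).le_one 1) (le_of_forall_lt_imp_le_of_dense ?_)
  intro a ha
  have hpos := optExcess_pos hγ hδ
  rcases le_or_gt a 0 with ha0 | ha0
  · exact ha0.trans ((isSubsolution_optCdf hγ hδ).nonneg 1)
  -- An admissible `K` below `optExcess / a`, scaled down to the optimal excess, retains mass
  -- `optExcess / K > a` at `1`.
  have hlt : optExcess γ δ < optExcess γ δ / a := by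
    rw [lt_div_iff₀ ha0]; nlinarith
  have hne : {K | 0 ≤ K ∧ ∃ G, IsSubsolution γ δ K G ∧ G 1 = 1}.Nonempty :=
    ⟨1, zero_le_one, exists_subsolution_one hγ hδ⟩
  obtain ⟨K, ⟨hK, G, hG, h1⟩, hKlt⟩ := exists_lt_of_csInf_lt hne hlt
  have hle := optExcess_le hK hG h1
  have hK0 : 0 < K := hpos.trans_le hle
  have hsub := hG.const_mul hδ (div_nonneg hpos.le hK) ((div_le_one hK0).2 hle)
  rw [div_mul_cancel₀ _ hK0.ne'] at hsub
  have := hsub.le_max 1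
  simp only [h1, mul_one] at this
  refine le_trans ?_ this
  rw [le_div_iff₀ hK0]
  rw [lt_div_iff₀ ha0] at hKlt
  linarith

lemma optExcess_add_integral (hγ : 2 ≤ γ) (hδ : 0 < δ) :
    optExcess γ δ + ∫ s in (0 : ℝ)..1, optCdf γ δ s = 1 := by
  have hF := isSubsolution_optCdf hγ hδ
  have hpos := optExcess_pos hγ hδ
  have h1 := hF.le_ratio zero_le_one le_rfl
  rw [optCdf_one hγ hδ, mul_one] at h1
  refine le_antisymm (not_lt.1 fun hlt => ?_) h1
  set A := optExcess γ δ + ∫ s in (0 : ℝ)..1, optCdf γ δ s with hA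
  -- If the ratio bound at `1` had slack, scaling by this `θ < 1` would leave both bounds there at
  -- least `1`. One application of `cdfBound` then restores mass one at the smaller excess `θ *
  -- optExcess`.
  set θ := max (1 / A) (1 - δ) with hθ
  have hθ0 : 0 < θ := lt_max_of_lt_left (by positivity)
  have hθ1 : θ < 1 := max_lt ((div_lt_one (by linarith)).2 hlt) (by linarith)
  have hθA : 1 ≤ θ * A := by
    have := le_max_left (1 / A) (1 - δ)
    rwa [div_le_iff₀ (by linarith), ← hθ] at this
  have hK : 0 ≤ θ * optExcess γ δ := by positivity
  have hsub := (hF.const_mul hδ hθ0.le hθ1.le).cdfBound hδ hK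
  have hγ' : (2 : ℝ) ≤ γ := by exact_mod_cast hγ
  have h2 := optExcess_le hK hsub ?_
  · nlinarith
  · refine min_eq_left (le_min ?_ ?_)
    · rw [unitClamp_of_one_le le_rfl, intervalIntegral.integral_const_mul]
      linarith
    · rw [unitClamp_of_one_le le_rfl]
      have h3 := hF.mono (show (1 : ℝ) ≤ γ * 1 - 1 by linarith)
      rw [optCdf_one hγ hδ] at h3
      have h4 := le_max_right (1 / A) (1 - δ)
      rw [← hθ] at h4
      nlinarith

end

/-! ### Regularity from one-sided slope bounds -/

lemma continuousWithinAt_Ici_of_slope_le {F : ℝ → ℝ} (hF : Monotone F) {x b C : ℝ} (hxb : x < b)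
    (h : ∀ y, x ≤ y → y ≤ b → F y - F x ≤ C * (y - x)) : ContinuousWithinAt F (Ici x) x := by
  have h1 : Tendsto (fun y => F x + C * (y - x)) (𝓝[≥] x) (𝓝 (F x)) := by
    have : ContinuousWithinAt (fun y => F x + C * (y - x)) (Ici x) x := by fun_prop
    simpa [ContinuousWithinAt] using this
  refine tendsto_of_tendsto_of_tendsto_of_le_of_le' tendsto_const_nhds h1 ?_ ?_
  · filter_upwards [self_mem_nhdsWithin] with y hy using hF hy
  · filter_upwards [Icc_mem_nhdsGE hxb] with y hy
    linarith [h y hy.1 hy.2]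

lemma clamp_sub_clamp_le (p q : ℝ) {x y : ℝ} (h : x ≤ y) :
    max p (min y q) - max p (min x q) ≤ y - x := by
  grind

lemma clamp_eq_clamp {p q a b : ℝ} (hpq : p ≤ q) (hab : a ≤ b) (h : min b q ≤ max a p) :
    max p (min b q) = max p (min a q) := by
  grind

lemma clamp_eq_of_le {p q a b : ℝ} (hpq : p ≤ q) (hab : a ≤ b) (h : max a p ≤ min b q) :
    max p (min b q) = min b q ∧ max p (min a q) = max a p := by
  grind

/-- With `G` the clamped `S`, the slope bound makes `H = C x - G` monotone as well. Since `G + H`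
generates `C` times Lebesgue measure, the measure of `G` is dominated by it. -/
lemma StieltjesFunction.restrict_Ioc_absolutelyContinuous (S : StieltjesFunction ℝ) {p q C : ℝ}
    (hC : 0 ≤ C) (hpq : p ≤ q) (h : ∀ x y, p ≤ x → x ≤ y → y ≤ q → S y - S x ≤ C * (y - x)) :
    S.measure.restrict (Ioc p q) ≪ volume := by
  set cl : ℝ → ℝ := fun x => max p (min x q) with hcl
  have cl_mono : Monotone cl := fun x y hxy => max_le_max le_rfl (min_le_min hxy le_rfl)
  have hcl_p : ∀ x, p ≤ cl x := fun x => le_max_left _ _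
  have hcl_q : ∀ x, cl x ≤ q := fun x => max_le hpq (min_le_right _ _)
  have cl_sub : ∀ x y, x ≤ y → cl y - cl x ≤ y - x := fun x y hxy => clamp_sub_clamp_le p q hxy
  have cl_cont : Continuous cl := by fun_prop
  let G : StieltjesFunction ℝ := ⟨fun x => S (cl x), S.mono.comp cl_mono, fun x =>
    (S.right_continuous (cl x)).comp cl_cont.continuousWithinAt fun y hy => cl_mono hy⟩
  have hG : ∀ x y, x ≤ y → S (cl y) - S (cl x) ≤ C * (y - x) := fun x y hxy =>
    (h _ _ (hcl_p x) (cl_mono hxy) (hcl_q y)).trans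
      (mul_le_mul_of_nonneg_left (cl_sub x y hxy) hC)
  let H : StieltjesFunction ℝ := ⟨fun x => C * x - S (cl x), fun x y hxy => by
      have := hG x y hxy
      dsimp only
      linarith, fun x =>
    ContinuousWithinAt.sub (by fun_prop) ((S.right_continuous (cl x)).comp
      cl_cont.continuousWithinAt fun y hy => cl_mono hy)⟩
  have hsum : G + H = Real.toNNReal C • StieltjesFunction.id := by
    ext x
    change S (cl x) + (C * x - S (cl x)) = Real.toNNReal C * x
    rw [Real.coe_toNNReal C hC]
    ring
  have hac : G.measure ≪ volume := by
    have h1 : G.measure ≤ Real.toNNReal C • (volume : Measure ℝ) := by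
      rw [Real.volume_eq_stieltjes_id, ← StieltjesFunction.measure_smul, ← hsum,
        StieltjesFunction.measure_add]
      exact Measure.le_add_right le_rfl
    exact (Measure.absolutelyContinuous_of_le h1).trans
      (Measure.smul_absolutelyContinuous)
  have heq : S.measure.restrict (Ioc p q) = G.measure := by
    refine Measure.ext_of_Ioc _ _ fun a b hab => ?_
    rw [Measure.restrict_apply measurableSet_Ioc, Ioc_inter_Ioc, S.measure_Ioc, G.measure_Ioc]
    change _ = ENNReal.ofReal (S (cl b) - S (cl a))
    rcases le_total (min b q) (max a p) with hle | hle
    · have h1 : cl b = cl a := clamp_eq_clamp hpq hab.le hle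
      rw [h1, sub_self, ENNReal.ofReal_zero, ENNReal.ofReal_eq_zero]
      have := S.mono hle
      linarith
    · have h1 : cl b = min b q := (clamp_eq_of_le hpq hab.le hle).1
      have h2 : cl a = max a p := (clamp_eq_of_le hpq hab.le hle).2
      rw [h1, h2]
  rw [heq]
  exact hac

/-! ### The intervals `P_j` and the regularity of the optimal distribution function -/

section
variable {γ : ℕ} (hγ : 2 ≤ γ)
include hγ

lemma leftEnd_succ (j : ℕ) : leftEnd γ (j + 1) = (1 + leftEnd γ j) / γ := by
  have hγ' : (2 : ℝ) ≤ γ := by exact_mod_cast hγ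
  have h1 : (γ : ℝ) - 1 ≠ 0 := by linarith
  have h2 : (γ : ℝ) ≠ 0 := by linarith
  unfold leftEnd
  field_simp
  ring

lemma leftEnd_succ_sub (j : ℕ) : leftEnd γ (j + 1) - leftEnd γ j = 1 / (γ : ℝ) ^ (j + 1) := by
  have hγ' : (2 : ℝ) ≤ γ := by exact_mod_cast hγ
  have h1 : (γ : ℝ) - 1 ≠ 0 := by linarith
  have h2 : (γ : ℝ) ≠ 0 := by linarith
  unfold leftEnd
  field_simp
  ring

lemma leftEnd_lt (j : ℕ) : leftEnd γ j < 1 / ((γ : ℝ) - 1) := by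
  have hγ' : (2 : ℝ) ≤ γ := by exact_mod_cast hγ
  unfold leftEnd
  have h1 : (0 : ℝ) < 1 / ((γ : ℝ) - 1) := by
    apply one_div_pos.2; linarith
  have h2 : (0 : ℝ) < 1 / (γ : ℝ) ^ j := by positivity
  nlinarith

lemma tendsto_leftEnd : Tendsto (leftEnd γ) atTop (𝓝 (1 / ((γ : ℝ) - 1))) := by
  have hγ' : (2 : ℝ) ≤ γ := by exact_mod_cast hγ
  have h : Tendsto (fun j : ℕ => 1 / (γ : ℝ) ^ j) atTop (𝓝 0) := by
    simpa using tendsto_pow_atTop_nhds_zero_of_lt_one (r := 1 / (γ : ℝ)) (by positivity)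
      ((div_lt_one (by linarith)).2 (by linarith))
  have h2 := (h.const_sub 1).const_mul (1 / ((γ : ℝ) - 1))
  rwa [sub_zero, mul_one] at h2

lemma leftEnd_strictMono : StrictMono (leftEnd γ) := strictMono_nat_of_lt_succ fun j => by
  have hγ' : (2 : ℝ) ≤ γ := by exact_mod_cast hγ
  have h := leftEnd_succ_sub hγ j
  have : (0 : ℝ) < 1 / (γ : ℝ) ^ (j + 1) := by positivity
  linarith

omit hγ in
lemma leftEnd_zero : leftEnd γ 0 = 0 := by simp [leftEnd]

lemma leftEnd_nonneg (j : ℕ) : 0 ≤ leftEnd γ j :=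
  leftEnd_zero (γ := γ) ▸ (leftEnd_strictMono hγ).monotone (Nat.zero_le j)

lemma accumulation_le_one : 1 / ((γ : ℝ) - 1) ≤ 1 := by
  have hγ' : (2 : ℝ) ≤ γ := by exact_mod_cast hγ
  rw [div_le_one (by linarith)]
  linarith

lemma leftEnd_lt_one (j : ℕ) : leftEnd γ j < 1 :=
  (leftEnd_lt hγ j).trans_le (accumulation_le_one hγ)

variable {δ : ℝ} (hδ : 0 < δ)
include hδ

lemma optCdf_of_nonpos {x : ℝ} (hx : x ≤ 0) : optCdf γ δ x = 0 := by
  have hF := isSubsolution_optCdf hγ hδ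
  have h := (hF.mono hx).trans (hF.le_ratio le_rfl zero_le_one)
  simp only [mul_zero, intervalIntegral.integral_same, add_zero] at h
  exact le_antisymm h (hF.nonneg x)

lemma optCdf_of_one_le {x : ℝ} (hx : 1 ≤ x) : optCdf γ δ x = 1 := by
  have hF := isSubsolution_optCdf hγ hδ
  exact le_antisymm (hF.le_one x) (optCdf_one hγ hδ ▸ hF.mono hx)

omit hγ hδ in
/-- The bound on the optimal distribution function coming from the expected ratio. -/
noncomputable def optRatioBound (γ : ℕ) (δ x : ℝ) : ℝ :=
  optExcess γ δ * x + ∫ s in (0 : ℝ)..x, optCdf γ δ s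

lemma optRatioBound_le_one {x : ℝ} (h0 : 0 ≤ x) (h1 : x ≤ 1) : optRatioBound γ δ x ≤ 1 := by
  have hF := isSubsolution_optCdf hγ hδ
  rw [optRatioBound, ← optExcess_add_integral hγ hδ]
  refine add_le_add ?_ (integral_mono_upper hF.mono hF.nonneg h0 h1)
  have := optExcess_pos hγ hδ
  nlinarith

lemma optRatioBound_sub_le {x y : ℝ} (hxy : x ≤ y) :
    optRatioBound γ δ y - optRatioBound γ δ x ≤ (optExcess γ δ + 1) * (y - x) := by
  have hF := isSubsolution_optCdf hγ hδ
  have h := intervalIntegral.integral_mono_on hxy hF.mono.intervalIntegrable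
    (intervalIntegrable_const (c := 1) (μ := volume)) fun s _ => hF.le_one s
  rw [intervalIntegral.integral_const, smul_eq_mul, mul_one] at h
  have h2 := intervalIntegral.integral_interval_sub_left (μ := volume) (a := 0) (b := y) (c := x)
    hF.mono.intervalIntegrable hF.mono.intervalIntegrable
  unfold optRatioBound
  linarith

lemma continuous_optRatioBound : Continuous (optRatioBound γ δ) := by
  have hF := isSubsolution_optCdf hγ hδ
  exact (by fun_prop : Continuous fun x => optExcess γ δ * x).add
    (intervalIntegral.continuous_primitive (fun _ _ => hF.mono.intervalIntegrable) 0)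

lemma optCdf_eq_min_unitClamp (x : ℝ) : optCdf γ δ x =
    min (optRatioBound γ δ (unitClamp x)) (δ + optCdf γ δ (γ * unitClamp x - 1)) := by
  have h := optRatioBound_le_one hγ hδ (unitClamp_nonneg x) (unitClamp_le_one x)
  rw [optCdf_eq_cdfBound hγ hδ x, cdfBound, ← optRatioBound]
  exact min_eq_right ((min_le_left _ _).trans h)

lemma optCdf_eq_min {x : ℝ} (h0 : 0 ≤ x) (h1 : x ≤ 1) : optCdf γ δ x =
    min (optRatioBound γ δ x) (δ + optCdf γ δ (γ * x - 1)) := by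
  rw [optCdf_eq_min_unitClamp hγ hδ, unitClamp_of_mem h0 h1]

/-- Each use of the tail term pulls `ℓ_(j+1)` back to `ℓ_j` at the cost of a factor `γ`. The
constants blow up with `j`, so the accumulation point needs its own argument. -/
lemma optCdf_sub_le_left (j : ℕ) : ∀ x y, x ≤ y → y ≤ leftEnd γ j →
    optCdf γ δ y - optCdf γ δ x ≤ (optExcess γ δ + 1) * (γ : ℝ) ^ j * (y - x) := by
  have hγ' : (2 : ℝ) ≤ γ := by exact_mod_cast hγ
  have hK := optExcess_pos hγ hδ
  induction j with
  | zero =>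
    intro x y hxy hy
    rw [leftEnd_zero] at hy
    rw [optCdf_of_nonpos hγ hδ hy, optCdf_of_nonpos hγ hδ (hxy.trans hy), sub_self]
    exact mul_nonneg (by positivity) (by linarith)
  | succ j ih =>
    intro x y hxy hy
    have huv := unitClamp_mono hxy
    have huv' := unitClamp_sub_le hxy
    have hv : unitClamp y ≤ leftEnd γ (j + 1) :=
      max_le (leftEnd_nonneg hγ _) ((min_le_left _ _).trans hy)
    rw [optCdf_eq_min_unitClamp hγ hδ x, optCdf_eq_min_unitClamp hγ hδ y]
    have h1 := optRatioBound_sub_le hγ hδ huv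
    have h2 := ih (γ * unitClamp x - 1) (γ * unitClamp y - 1) (by gcongr) (by
      rw [leftEnd_succ hγ, le_div_iff₀ (by linarith)] at hv
      linarith)
    have hpow : (1 : ℝ) ≤ (γ : ℝ) ^ (j + 1) := one_le_pow₀ (by linarith)
    have h3 : (optExcess γ δ + 1) * (unitClamp y - unitClamp x) ≤
        (optExcess γ δ + 1) * (γ : ℝ) ^ (j + 1) * (y - x) := by
      have : (optExcess γ δ + 1) * 1 ≤ (optExcess γ δ + 1) * (γ : ℝ) ^ (j + 1) := by gcongr
      rw [mul_one] at this
      exact mul_le_mul this huv' (by linarith) (by positivity)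
    have h4 : (optExcess γ δ + 1) * (γ : ℝ) ^ j *
        (γ * unitClamp y - 1 - (γ * unitClamp x - 1)) ≤
        (optExcess γ δ + 1) * (γ : ℝ) ^ (j + 1) * (y - x) := by
      have : (optExcess γ δ + 1) * (γ : ℝ) ^ j *
        (γ * unitClamp y - 1 - (γ * unitClamp x - 1)) =
        (optExcess γ δ + 1) * (γ : ℝ) ^ (j + 1) * (unitClamp y - unitClamp x) := by ring
      rw [this]
      gcongr
    generalize (optExcess γ δ + 1) * (γ : ℝ) ^ (j + 1) * (y - x) = d at *
    rcases min_cases (optRatioBound γ δ (unitClamp x)) (δ + optCdf γ δ (γ * unitClamp x - 1))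
      with ⟨h, _⟩ | ⟨h, _⟩ <;> rw [h]
    · have := min_le_left (optRatioBound γ δ (unitClamp y)) (δ + optCdf γ δ (γ * unitClamp y - 1))
      linarith
    · have := min_le_right (optRatioBound γ δ (unitClamp y)) (δ + optCdf γ δ (γ * unitClamp y - 1))
      linarith

/-- Here `γ u - 1 ≥ u`, so the tail term is at least `δ + F u > F u` and cannot attain the minimum.
-/
lemma optCdf_eq_optRatioBound {x : ℝ} (hx : 1 / ((γ : ℝ) - 1) ≤ x) :
    optCdf γ δ x = optRatioBound γ δ (unitClamp x) := by
  have hγ' : (2 : ℝ) ≤ γ := by exact_mod_cast hγ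
  have hu : 1 / ((γ : ℝ) - 1) ≤ unitClamp x :=
    le_max_of_le_right (le_min hx (accumulation_le_one hγ))
  have h1 : optCdf γ δ x = optCdf γ δ (unitClamp x) := by
    rw [optCdf_eq_min_unitClamp hγ hδ x,
      optCdf_eq_min hγ hδ (unitClamp_nonneg x) (unitClamp_le_one x)]
  rw [div_le_iff₀ (by linarith)] at hu
  have h2 := (isSubsolution_optCdf hγ hδ).mono
    (show unitClamp x ≤ γ * unitClamp x - 1 by linarith)
  have h3 := optCdf_eq_min_unitClamp hγ hδ x
  rcases min_choice (optRatioBound γ δ (unitClamp x)) (δ + optCdf γ δ (γ * unitClamp x - 1))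
    with h | h <;> rw [h] at h3
  · exact h3
  · linarith

lemma optCdf_sub_le_right {x y : ℝ} (hx : 1 / ((γ : ℝ) - 1) ≤ x) (hxy : x ≤ y) :
    optCdf γ δ y - optCdf γ δ x ≤ (optExcess γ δ + 1) * (y - x) := by
  have hK := optExcess_pos hγ hδ
  rw [optCdf_eq_optRatioBound hγ hδ hx, optCdf_eq_optRatioBound hγ hδ (hx.trans hxy)]
  refine (optRatioBound_sub_le hγ hδ (unitClamp_mono hxy)).trans ?_
  have := unitClamp_sub_le hxy
  gcongr

omit hδ in
lemma exists_lt_leftEnd {x : ℝ} (hx : x < 1 / ((γ : ℝ) - 1)) : ∃ j, x < leftEnd γ j :=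
  ((tendsto_leftEnd hγ).eventually (lt_mem_nhds hx)).exists

lemma continuousWithinAt_optCdf (x : ℝ) : ContinuousWithinAt (optCdf γ δ) (Ici x) x := by
  have hF := isSubsolution_optCdf hγ hδ
  rcases lt_or_ge x (1 / ((γ : ℝ) - 1)) with hx | hx
  · obtain ⟨j, hj⟩ := exists_lt_leftEnd hγ hx
    exact continuousWithinAt_Ici_of_slope_le hF.mono hj
      fun y hxy hy => optCdf_sub_le_left hγ hδ j x y hxy hy
  · exact continuousWithinAt_Ici_of_slope_le hF.mono (lt_add_one x)
      fun y hxy _ => optCdf_sub_le_right hγ hδ hx hxy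

lemma leftLim_optCdf_accumulation :
    Function.leftLim (optCdf γ δ) (1 / ((γ : ℝ) - 1)) = optCdf γ δ (1 / ((γ : ℝ) - 1)) := by
  have hγ' : (2 : ℝ) ≤ γ := by exact_mod_cast hγ
  have hF := isSubsolution_optCdf hγ hδ
  set L := 1 / ((γ : ℝ) - 1) with hL
  set s := Function.leftLim (optCdf γ δ) L
  have hl : Tendsto (leftEnd γ) atTop (𝓝[<] L) :=
    tendsto_nhdsWithin_iff.2 ⟨tendsto_leftEnd hγ, Eventually.of_forall (leftEnd_lt hγ)⟩
  have h1 : Tendsto (fun j => optCdf γ δ (leftEnd γ j)) atTop (𝓝 s) :=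
    (hF.mono.tendsto_leftLim L).comp hl
  have h2 : Tendsto (fun j => optRatioBound γ δ (leftEnd γ (j + 1))) atTop
      (𝓝 (optRatioBound γ δ L)) :=
    ((continuous_optRatioBound hγ hδ).tendsto L).comp
      ((tendsto_leftEnd hγ).comp (tendsto_add_atTop_nat 1))
  have h3 := h2.min (h1.const_add δ)
  -- Limit of the fixed-point equation along `ℓ_(j+1)`. As `δ > 0`, the minimum cannot be `δ + s`,
  -- so there is no jump at `L`.
  have h4 : s = min (optRatioBound γ δ L) (δ + s) := by
    refine tendsto_nhds_unique (h1.comp (tendsto_add_atTop_nat 1)) (h3.congr fun j => ?_)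
    have h5 : (γ : ℝ) * leftEnd γ (j + 1) - 1 = leftEnd γ j := by
      rw [leftEnd_succ hγ]
      field_simp
      ring
    have h6 := optCdf_eq_min hγ hδ (leftEnd_nonneg hγ (j + 1)) (leftEnd_lt_one hγ (j + 1)).le
    rw [h5] at h6
    exact h6.symm
  have hL0 : 0 ≤ L := by
    rw [hL]; apply one_div_nonneg.2; linarith
  rw [optCdf_eq_optRatioBound hγ hδ le_rfl, unitClamp_of_mem hL0 (accumulation_le_one hγ)]
  rcases min_choice (optRatioBound γ δ L) (δ + s) with h | h <;> rw [h] at h4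
  · exact h4
  · linarith

end

/-! ### Explicit form on the intervals `P_j` -/

section
variable {γ : ℕ} (hγ : 2 ≤ γ) {δ : ℝ} (hδ : 0 < δ)

/-- Length of the support of the optimal density in the first interval. -/
noncomputable def supportLength (γ : ℕ) (δ : ℝ) : ℝ := Real.log (1 + δ / optExcess γ δ)

include hγ hδ

lemma supportLength_pos : 0 < supportLength γ δ := by
  have := div_pos hδ (optExcess_pos hγ hδ)
  exact Real.log_pos (by linarith)

lemma exp_supportLength : optExcess γ δ * (Real.exp (supportLength γ δ) - 1) = δ := by
  have hK := optExcess_pos hγ hδ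
  have := div_pos hδ hK
  rw [supportLength, Real.exp_log (by linarith)]
  field_simp
  ring

lemma exp_le_iff_le_supportLength {x : ℝ} :
    optExcess γ δ * (Real.exp x - 1) ≤ δ ↔ x ≤ supportLength γ δ := by
  have hK := optExcess_pos hγ hδ
  have h : optExcess γ δ * (Real.exp x - 1) ≤ δ ↔ optExcess γ δ * (Real.exp x - 1) ≤
      optExcess γ δ * (Real.exp (supportLength γ δ) - 1) := by
    rw [exp_supportLength hγ hδ]
  rw [h, mul_le_mul_iff_right₀ hK, sub_le_sub_iff_right, Real.exp_le_exp]

lemma min_exp_eq_min_integral {x : ℝ} (hx : 0 ≤ x) :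
    min δ (optExcess γ δ * (Real.exp x - 1)) = min (optExcess γ δ * x +
      ∫ s in (0 : ℝ)..x, min δ (optExcess γ δ * (Real.exp s - 1))) δ := by
  have hK := optExcess_pos hγ hδ
  have key : ∀ y, 0 ≤ y → y ≤ supportLength γ δ → optExcess γ δ * y +
      ∫ s in (0 : ℝ)..y, min δ (optExcess γ δ * (Real.exp s - 1)) =
      optExcess γ δ * (Real.exp y - 1) := fun y hy0 hy => by
    have : ∫ s in (0 : ℝ)..y, min δ (optExcess γ δ * (Real.exp s - 1)) =
        ∫ s in (0 : ℝ)..y, optExcess γ δ * (Real.exp s - 1) := by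
      refine intervalIntegral.integral_congr fun s hs => ?_
      rw [uIcc_of_le hy0] at hs
      exact min_eq_right ((exp_le_iff_le_supportLength hγ hδ).2 (hs.2.trans hy))
    rw [this, integral_exp_sub_one]
    ring
  have hc : Continuous fun s => min δ (optExcess γ δ * (Real.exp s - 1)) := by fun_prop
  rcases le_total x (supportLength γ δ) with h | h
  · rw [key x hx h, min_comm]
  · have h0 := (supportLength_pos hγ hδ).le
    have h1 : δ ≤ optExcess γ δ * (Real.exp x - 1) := by
      conv_lhs => rw [← exp_supportLength hγ hδ]
      gcongr
    rw [min_eq_left h1, min_eq_right]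
    have h2 := key _ h0 le_rfl
    rw [exp_supportLength hγ hδ] at h2
    rw [← intervalIntegral.integral_add_adjacent_intervals (hc.intervalIntegrable 0
      (supportLength γ δ)) (hc.intervalIntegrable _ x)]
    have h3 : 0 ≤ ∫ s in supportLength γ δ..x, min δ (optExcess γ δ * (Real.exp s - 1)) :=
      intervalIntegral.integral_nonneg h fun s hs => le_min hδ.le
        (mul_nonneg hK.le (by linarith [Real.add_one_le_exp s, hs.1]))
    nlinarith

/-- Both sides solve the same integral equation, and `min` is nonexpansive, so Grönwall applies to
the absolute difference. -/
lemma optCdf_on_first {x : ℝ} (h0 : 0 ≤ x) (h1 : x ≤ leftEnd γ 1) :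
    optCdf γ δ x = min δ (optExcess γ δ * (Real.exp x - 1)) := by
  have hγ' : (2 : ℝ) ≤ γ := by exact_mod_cast hγ
  have hF := isSubsolution_optCdf hγ hδ
  have hc : Continuous fun s => min δ (optExcess γ δ * (Real.exp s - 1)) := by fun_prop
  have hi : ∀ a b, IntervalIntegrable
      (fun s => optCdf γ δ s - min δ (optExcess γ δ * (Real.exp s - 1))) volume a b := fun a b =>
    hF.mono.intervalIntegrable.sub (hc.intervalIntegrable a b)
  have hw := nonpos_of_le_integral
    (w := fun s => |optCdf γ δ s - min δ (optExcess γ δ * (Real.exp s - 1))|)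
    (leftEnd_nonneg hγ 1) (leftEnd_lt_one hγ 1).le (hi _ _).abs (fun _ _ => abs_nonneg _)
    (fun y hy => ?_) x ⟨h0, h1⟩
  · exact sub_eq_zero.1 (abs_nonpos_iff.1 hw)
  · have hy1 : y ≤ 1 := hy.2.trans (leftEnd_lt_one hγ 1).le
    have h2 : γ * y - 1 ≤ 0 := by
      have := hy.2
      rw [leftEnd_succ hγ, leftEnd_zero, le_div_iff₀ (by linarith)] at this
      linarith
    rw [optCdf_eq_min hγ hδ hy.1 hy1, optCdf_of_nonpos hγ hδ h2, add_zero,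
      min_exp_eq_min_integral hγ hδ hy.1]
    refine (abs_min_sub_min_le_max _ _ _ _).trans (max_le ?_ ?_)
    · rw [optRatioBound, add_sub_add_left_eq_sub, ← intervalIntegral.integral_sub
        hF.mono.intervalIntegrable (hc.intervalIntegrable _ _)]
      exact intervalIntegral.abs_integral_le_integral_abs hy.1
    · rw [sub_self, abs_zero]
      exact intervalIntegral.integral_nonneg hy.1 fun _ _ => abs_nonneg _

lemma optCdf_on_piece (j : ℕ) (hj : ((j : ℝ) + 1) * (2 * γ * δ) < 1) :
    ∀ x ∈ Icc (leftEnd γ j) (leftEnd γ (j + 1)), optCdf γ δ x = j * δ +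
      min δ (optExcess γ δ * (Real.exp ((γ : ℝ) ^ j * (x - leftEnd γ j)) - 1)) := by
  have hγ' : (2 : ℝ) ≤ γ := by exact_mod_cast hγ
  have hK := half_le_optExcess hγ hδ
  have hF := isSubsolution_optCdf hγ hδ
  induction j with
  | zero =>
    intro x hx
    rw [leftEnd_zero] at hx ⊢
    simpa using optCdf_on_first hγ hδ hx.1 hx.2
  | succ j ih =>
    intro x hx
    have hx1 : x ≤ 1 := hx.2.trans (leftEnd_lt_one hγ _).le
    have hx0 : 0 ≤ x := (leftEnd_nonneg hγ _).trans hx.1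
    have hz : γ * x - 1 ∈ Icc (leftEnd γ j) (leftEnd γ (j + 1)) := by
      have h1 := hx.1
      have h2 := hx.2
      rw [leftEnd_succ hγ, div_le_iff₀ (by linarith)] at h1
      rw [leftEnd_succ hγ, le_div_iff₀ (by linarith)] at h2
      constructor <;> linarith
    have hpos : 0 < 2 * γ * δ := by positivity
    push_cast at hj ⊢
    have h3 := ih (by nlinarith) _ hz
    have harg : (γ : ℝ) ^ j * (γ * x - 1 - leftEnd γ j) =
        (γ : ℝ) ^ (j + 1) * (x - leftEnd γ (j + 1)) := by
      rw [leftEnd_succ hγ]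
      field_simp
      ring
    rw [harg] at h3
    -- The tail term is at most `(j + 2) δ ≤ x / 2 ≤ K x`, because `x ≥ ℓ_1 = 1 / γ`.
    rw [optCdf_eq_min hγ hδ hx0 hx1, h3, min_eq_right]
    · ring
    · have h4 := min_le_left δ
        (optExcess γ δ * (Real.exp ((γ : ℝ) ^ (j + 1) * (x - leftEnd γ (j + 1))) - 1))
      have h5 : 0 ≤ ∫ s in (0 : ℝ)..x, optCdf γ δ s :=
        intervalIntegral.integral_nonneg hx0 fun s _ => hF.nonneg s
      have h6 : 1 ≤ x * γ := by
        have := (leftEnd_strictMono hγ).monotone (Nat.le_add_left 1 j) |>.trans hx.1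
        rwa [leftEnd_succ hγ, leftEnd_zero, add_zero, div_le_iff₀ (by linarith)] at this
      have h7 : ((j : ℝ) + 1 + 1) * δ ≤ 1 / 2 * x := by
        refine le_of_mul_le_mul_right ?_ (show (0 : ℝ) < 2 * γ by positivity)
        nlinarith
      have h8 : 1 / 2 * x ≤ optExcess γ δ * x := by gcongr
      unfold optRatioBound
      linarith

/-! ### The optimal law and its density -/

/-- The optimal distribution function as a Stieltjes function. -/
noncomputable def optStieltjes : StieltjesFunction ℝ where
  toFun := optCdf γ δ
  mono' := (isSubsolution_optCdf hγ hδ).mono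
  right_continuous' := continuousWithinAt_optCdf hγ hδ

lemma tendsto_optStieltjes_atBot : Tendsto (optStieltjes hγ hδ) atBot (𝓝 0) :=
  tendsto_const_nhds.congr' <| (eventually_le_atBot 0).mono fun _ hx =>
    (optCdf_of_nonpos hγ hδ hx).symm

lemma tendsto_optStieltjes_atTop : Tendsto (optStieltjes hγ hδ) atTop (𝓝 1) :=
  tendsto_const_nhds.congr' <| (eventually_ge_atTop 1).mono fun _ hx =>
    (optCdf_of_one_le hγ hδ hx).symm

lemma isPurchaseDistribution_optStieltjes :
    IsPurchaseDistribution (optStieltjes hγ hδ).measure := by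
  have hp := (optStieltjes hγ hδ).isProbabilityMeasure (tendsto_optStieltjes_atBot hγ hδ)
    (tendsto_optStieltjes_atTop hγ hδ)
  refine ⟨hp, (prob_compl_eq_zero_iff measurableSet_Ioc).2 ?_⟩
  rw [StieltjesFunction.measure_Ioc]
  change ENNReal.ofReal (optCdf γ δ 1 - optCdf γ δ 0) = 1
  rw [optCdf_one hγ hδ, optCdf_of_nonpos hγ hδ le_rfl]
  simp

lemma cdf_optStieltjes : cdf (optStieltjes hγ hδ).measure = optStieltjes hγ hδ :=
  cdf_measure_stieltjesFunction _ (tendsto_optStieltjes_atBot hγ hδ)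
    (tendsto_optStieltjes_atTop hγ hδ)

lemma absolutelyContinuous_optStieltjes : (optStieltjes hγ hδ).measure ≪ volume := by
  have hγ' : (2 : ℝ) ≤ γ := by exact_mod_cast hγ
  have hK := optExcess_pos hγ hδ
  set μ := (optStieltjes hγ hδ).measure
  set L := 1 / ((γ : ℝ) - 1) with hL
  have hleft : ∀ j, μ.restrict (Ioc 0 (leftEnd γ j)) ≪ volume := fun j =>
    (optStieltjes hγ hδ).restrict_Ioc_absolutelyContinuous
      (C := (optExcess γ δ + 1) * (γ : ℝ) ^ j) (by positivity)
      (leftEnd_nonneg hγ j) fun x y _ hxy hy => optCdf_sub_le_left hγ hδ j x y hxy hy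
  have hright : μ.restrict (Ioc L 1) ≪ volume :=
    (optStieltjes hγ hδ).restrict_Ioc_absolutelyContinuous (C := optExcess γ δ + 1)
      (by positivity) (accumulation_le_one hγ)
      fun x y hx hxy _ => optCdf_sub_le_right hγ hδ hx hxy
  have hL0 : μ {L} = 0 := by
    rw [StieltjesFunction.measure_singleton]
    change ENNReal.ofReal (optCdf γ δ L - Function.leftLim (optCdf γ δ) L) = 0
    rw [leftLim_optCdf_accumulation hγ hδ, sub_self, ENNReal.ofReal_zero]
  intro s hs
  have hcover : s ⊆ (Ioc (0 : ℝ) 1)ᶜ ∪ ((⋃ j, s ∩ Ioc 0 (leftEnd γ j)) ∪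
      ({L} ∪ (s ∩ Ioc L 1))) := by
    intro x hx
    by_cases h : x ∈ Ioc (0 : ℝ) 1
    · right
      rcases lt_trichotomy x L with hlt | heq | hgt
      · left
        obtain ⟨j, hj⟩ := exists_lt_leftEnd hγ hlt
        exact mem_iUnion.2 ⟨j, hx, h.1, hj.le⟩
      · exact Or.inr (Or.inl heq)
      · exact Or.inr (Or.inr ⟨hx, hgt, h.2⟩)
    · exact Or.inl h
  refine measure_mono_null hcover (measure_union_null
    (isPurchaseDistribution_optStieltjes hγ hδ).support (measure_union_null
      (measure_iUnion_null fun j => ?_) (measure_union_null hL0 ?_)))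
  · rw [← Measure.restrict_apply' measurableSet_Ioc]
    exact hleft j hs
  · rw [← Measure.restrict_apply' measurableSet_Ioc]
    exact hright hs

omit hγ hδ in
/-- The optimal density: the left derivative of the optimal distribution function. -/
noncomputable def optDensity (γ : ℕ) (δ t : ℝ) : ℝ :=
  derivWithin (fun y => -optCdf γ δ (-y)) (Ici (-t)) (-t)

omit hγ hδ in
lemma measurable_optDensity : Measurable (optDensity γ δ) :=
  (measurable_derivWithin_Ici fun y => -optCdf γ δ (-y)).comp measurable_neg

lemma optDensity_nonneg (t : ℝ) : 0 ≤ optDensity γ δ t := by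
  refine MonotoneOn.derivWithin_nonneg fun x _ y _ hxy => ?_
  have := (isSubsolution_optCdf hγ hδ).mono (neg_le_neg hxy)
  exact neg_le_neg this

-- Only values to the left of `t` matter, so the density formulas hold at the right end points of
-- half-open intervals, where `F` may have a kink.
omit hγ hδ in
lemma optDensity_eq {t b d : ℝ} {g : ℝ → ℝ} (hb : b < t) (hg : HasDerivAt g d t)
    (h : ∀ x, b < x → x ≤ t → optCdf γ δ x = g x) : optDensity γ δ t = d := by
  have h1 : HasDerivAt (fun y => -g (-y)) d (-t) := by
    have h2 : HasDerivAt g d (- -t) := by rwa [neg_neg]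
    have h3 := (h2.comp (-t) (hasDerivAt_neg (-t))).neg
    rwa [mul_neg_one, neg_neg] at h3
  refine (h1.hasDerivWithinAt.congr_of_eventuallyEq ?_ ?_).derivWithin
    (uniqueDiffOn_Ici _ _ self_mem_Ici)
  · filter_upwards [Ico_mem_nhdsGE (neg_lt_neg hb)] with y hy
    rw [h (-y) (by linarith [hy.2]) (by linarith [hy.1])]
  · rw [h (- -t) (by linarith) (by linarith)]

lemma densityLaw_optDensity : densityLaw (optDensity γ δ) = (optStieltjes hγ hδ).measure := by
  have hp := (isPurchaseDistribution_optStieltjes hγ hδ).isProbabilityMeasure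
  rw [densityLaw, ← Measure.withDensity_rnDeriv_eq _ _ (absolutelyContinuous_optStieltjes hγ hδ)]
  refine withDensity_congr_ae ?_
  filter_upwards [(optStieltjes hγ hδ).ae_hasDerivAt,
    Measure.rnDeriv_lt_top (optStieltjes hγ hδ).measure volume] with t ht hfin
  rw [optDensity_eq (sub_one_lt t) ht fun x _ _ => rfl, ENNReal.ofReal_toReal hfin.ne]

lemma optDensity_on_support {j : ℕ} (hj : ((j : ℝ) + 1) * (2 * γ * δ) < 1)
    (hlen : supportLength γ δ / (γ : ℝ) ^ j < leftEnd γ (j + 1) - leftEnd γ j) {t : ℝ}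
    (ht : t ∈ Ioc (leftEnd γ j) (leftEnd γ j + supportLength γ δ / (γ : ℝ) ^ j)) :
    optDensity γ δ t = optExcess γ δ * (γ : ℝ) ^ j * Real.exp (-((γ : ℝ) ^ j * leftEnd γ j)) *
      Real.exp ((γ : ℝ) ^ j * t) := by
  have hpow : (0 : ℝ) < (γ : ℝ) ^ j := by
    have : 0 < γ := by omega
    positivity
  have hd : HasDerivAt (fun x => j * δ + optExcess γ δ *
      (Real.exp ((γ : ℝ) ^ j * (x - leftEnd γ j)) - 1))
      (optExcess γ δ * (Real.exp ((γ : ℝ) ^ j * (t - leftEnd γ j)) * ((γ : ℝ) ^ j * 1))) t :=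
    ((((((hasDerivAt_id t).sub_const _).const_mul _).exp).sub_const _).const_mul _).const_add _
  rw [optDensity_eq ht.1 hd fun x hx hxt => ?_]
  · rw [mul_assoc _ (Real.exp _) (Real.exp _), ← Real.exp_add, mul_one,
      show (γ : ℝ) ^ j * (t - leftEnd γ j) =
        -((γ : ℝ) ^ j * leftEnd γ j) + (γ : ℝ) ^ j * t by ring]
    ring
  · rw [optCdf_on_piece hγ hδ j hj x ⟨hx.le, by linarith [ht.2]⟩, min_eq_right]
    rw [exp_le_iff_le_supportLength hγ hδ, mul_comm, ← le_div_iff₀ hpow]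
    linarith [ht.2]

lemma optDensity_off_support {j : ℕ} (hj : ((j : ℝ) + 1) * (2 * γ * δ) < 1) {t : ℝ}
    (ht : t ∈ Ioc (leftEnd γ j + supportLength γ δ / (γ : ℝ) ^ j) (leftEnd γ (j + 1))) :
    optDensity γ δ t = 0 := by
  have hpow : (0 : ℝ) < (γ : ℝ) ^ j := by
    have : 0 < γ := by omega
    positivity
  refine optDensity_eq ht.1 (hasDerivAt_const t (j * δ + δ)) fun x hx hxt => ?_
  have h0 : 0 ≤ supportLength γ δ / (γ : ℝ) ^ j := by
    have := supportLength_pos hγ hδ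
    positivity
  rw [optCdf_on_piece hγ hδ j hj x ⟨by linarith, hxt.trans ht.2⟩, min_eq_left]
  refine le_of_not_ge fun hle => ?_
  rw [exp_le_iff_le_supportLength hγ hδ, mul_comm, ← le_div_iff₀ hpow] at hle
  linarith

lemma supportLength_div_lt {j : ℕ} (h : 2 * γ * δ < 1) :
    supportLength γ δ / (γ : ℝ) ^ j < leftEnd γ (j + 1) - leftEnd γ j := by
  have hγ' : (2 : ℝ) ≤ γ := by exact_mod_cast hγ
  have hK := half_le_optExcess hγ hδ
  have hdiv : 0 < δ / optExcess γ δ := div_pos hδ (by linarith)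
  -- `log (1 + u) < u`; with `K ≥ 1/2` the support length stays below `1 / γ`.
  have h1 : supportLength γ δ < δ / optExcess γ δ := by
    have := Real.log_lt_sub_one_of_pos (show 0 < 1 + δ / optExcess γ δ by linarith) (by linarith)
    unfold supportLength
    linarith
  have h2 : δ / optExcess γ δ ≤ 1 / γ := by
    rw [div_le_div_iff₀ (by linarith) (by linarith)]
    nlinarith
  rw [leftEnd_succ_sub hγ, pow_succ', ← div_div]
  gcongr
  linarith

end

/-! ### Ratio and tail constraints in terms of the distribution function -/

lemma setOf_lt_skiRatio {γ x : ℝ} (hγ : 1 ≤ γ) (hx : 0 < x) :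
    {t : ℝ | γ < skiRatio t x} = Ioc (γ * x - 1) x := by
  ext t
  simp only [mem_ofPred_eq, skiRatio, mem_Ioc]
  split_ifs with h
  · constructor
    · intro h'; linarith
    · intro h'; linarith [h'.2]
  · rw [lt_div_iff₀ hx]
    constructor
    · intro h'; exact ⟨by linarith, not_lt.1 h⟩
    · intro h'; linarith [h'.1]

/-- Fubini for `max 0 (x - t) = ∫₀ˣ 1_{t ≤ s} ds`, valid for `t > 0`. -/
lemma integral_max_sub_eq_integral_cdf (ν : Measure ℝ) [IsProbabilityMeasure ν]
    (h : ∀ᵐ t ∂ν, 0 < t) {x : ℝ} (hx : 0 ≤ x) :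
    ∫ t, max 0 (x - t) ∂ν = ∫ s in (0 : ℝ)..x, cdf ν s := by
  have hmeas : MeasurableSet {p : ℝ × ℝ | p.1 ≤ p.2} :=
    measurableSet_le measurable_fst measurable_snd
  have h1 : ∀ᵐ t ∂ν, max 0 (x - t) =
      ∫ s in Ioc 0 x, {p : ℝ × ℝ | p.1 ≤ p.2}.indicator (fun _ => (1 : ℝ)) (t, s) := by
    filter_upwards [h] with t ht
    have : (fun s => {p : ℝ × ℝ | p.1 ≤ p.2}.indicator (fun _ => (1 : ℝ)) (t, s)) =
        (Ici t).indicator fun _ => 1 := by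
      ext s
      simp [indicator]
    rw [this, integral_indicator_const _ measurableSet_Ici,
      measureReal_restrict_apply measurableSet_Ici]
    have h2 : (Ici t ∩ Ioc 0 x) = Icc t x := by
      ext s
      simp only [mem_inter_iff, mem_Ici, mem_Ioc, mem_Icc]
      constructor
      · rintro ⟨h, _, h'⟩; exact ⟨h, h'⟩
      · rintro ⟨h, h'⟩; exact ⟨h, ht.trans_le h, h'⟩
    rw [h2, Measure.real, Real.volume_Icc, ENNReal.toReal_ofReal', max_comm]
    simp
  rw [integral_congr_ae h1, integral_integral_swap
    (f := fun t s => {p : ℝ × ℝ | p.1 ≤ p.2}.indicator (fun _ => (1 : ℝ)) (t, s))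
    ((integrable_const (1 : ℝ)).indicator hmeas), intervalIntegral.integral_of_le hx]
  refine integral_congr_ae (Eventually.of_forall fun s => ?_)
  have : (fun t => {p : ℝ × ℝ | p.1 ≤ p.2}.indicator (fun _ => (1 : ℝ)) (t, s)) =
      (Iic s).indicator fun _ => 1 := by
    ext t
    simp [indicator]
  simp only [this]
  rw [integral_indicator_const _ measurableSet_Iic, cdf_eq_real]
  simp

namespace IsPurchaseDistribution
variable {ν : Measure ℝ}

lemma ae_mem (hν : IsPurchaseDistribution ν) : ∀ᵐ t ∂ν, t ∈ Ioc (0 : ℝ) 1 :=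
  hν.support

lemma expectedRatio_eq (hν : IsPurchaseDistribution ν) {x : ℝ} (hx : 0 < x) :
    expectedRatio ν x =
      ENNReal.ofReal (1 + (cdf ν x - ∫ s in (0 : ℝ)..x, cdf ν s) / x) := by
  have hp := hν.isProbabilityMeasure
  have hrep : ∀ t, skiRatio t x =
      1 + ((Iic x).indicator (fun _ => (1 : ℝ)) t - max 0 (x - t)) / x := by
    intro t
    simp only [skiRatio, indicator, mem_Iic]
    rcases lt_or_ge x t with h | h
    · rw [if_pos h, if_neg (not_le.2 h), max_eq_left (by linarith)]
      simp
    · rw [if_neg (not_lt.2 h), if_pos h, max_eq_right (by linarith)]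
      field_simp
      ring
  have hi1 : Integrable ((Iic x).indicator fun _ => (1 : ℝ)) ν :=
    (integrable_const 1).indicator measurableSet_Iic
  have hi2 : Integrable (fun t => max 0 (x - t)) ν := by
    refine Integrable.of_bound (by fun_prop) x ?_
    filter_upwards [hν.ae_mem] with t ht
    rw [Real.norm_of_nonneg (le_max_left _ _)]
    exact max_le hx.le (by linarith [ht.1])
  have hi3 : Integrable (fun t => ((Iic x).indicator (fun _ => (1 : ℝ)) t - max 0 (x - t)) / x) ν :=
    (hi1.sub hi2).div_const x
  have hi : Integrable (fun t => skiRatio t x) ν := by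
    simp_rw [hrep]
    exact (integrable_const 1).add hi3
  rw [expectedRatio, ← ofReal_integral_eq_lintegral_ofReal hi]
  · simp_rw [hrep]
    rw [integral_add (integrable_const 1) hi3, integral_div, integral_sub hi1 hi2,
      integral_indicator_const _ measurableSet_Iic, integral_max_sub_eq_integral_cdf ν
      (hν.ae_mem.mono fun t ht => ht.1) hx.le, cdf_eq_real]
    simp
  · filter_upwards [hν.ae_mem] with t ht
    simp only [skiRatio, Pi.zero_apply]
    split_ifs
    · exact zero_le_one
    · have := ht.1
      positivity

lemma cdf_of_nonpos (hν : IsPurchaseDistribution ν) {x : ℝ} (hx : x ≤ 0) : cdf ν x = 0 := by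
  have hp := hν.isProbabilityMeasure
  have hsub : Iic x ⊆ (Ioc (0 : ℝ) 1)ᶜ := by
    intro t ht h
    exact absurd h.1 (not_lt.2 ((mem_Iic.1 ht).trans hx))
  have : ν (Iic x) = 0 := measure_mono_null hsub hν.support
  rw [cdf_eq_real, Measure.real, this, ENNReal.toReal_zero]

lemma cdf_of_one_le (hν : IsPurchaseDistribution ν) {x : ℝ} (hx : 1 ≤ x) : cdf ν x = 1 := by
  have hp := hν.isProbabilityMeasure
  have : ν (Iic x) = 1 := by
    rw [← prob_compl_eq_zero_iff measurableSet_Iic]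
    have hsub : (Iic x)ᶜ ⊆ (Ioc (0 : ℝ) 1)ᶜ := by
      intro t ht h
      exact ht (mem_Iic.2 (h.2.trans hx))
    exact measure_mono_null hsub hν.support
  rw [cdf_eq_real, Measure.real, this, ENNReal.toReal_one]

lemma cdf_unitClamp (hν : IsPurchaseDistribution ν) (x : ℝ) : cdf ν (unitClamp x) = cdf ν x := by
  rcases le_total x 0 with h0 | h0
  · rw [unitClamp_of_nonpos h0, hν.cdf_of_nonpos h0, hν.cdf_of_nonpos le_rfl]
  rcases le_total x 1 with h1 | h1
  · rw [unitClamp_of_mem h0 h1]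
  · rw [unitClamp_of_one_le h1, hν.cdf_of_one_le h1, hν.cdf_of_one_le le_rfl]

lemma tail_iff (hν : IsPurchaseDistribution ν) {γ δ x : ℝ} (hγ : 1 ≤ γ) (hδ : 0 < δ)
    (hx : 0 < x) : ν {t : ℝ | γ < skiRatio t x} ≤ ENNReal.ofReal δ ↔
      cdf ν x ≤ δ + cdf ν (γ * x - 1) := by
  have hp := hν.isProbabilityMeasure
  rw [setOf_lt_skiRatio hγ hx]
  nth_rewrite 1 [← measure_cdf ν]
  rw [StieltjesFunction.measure_Ioc, ENNReal.ofReal_le_ofReal_iff hδ.le]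
  constructor <;> intro h <;> linarith

lemma competitiveRatio_le_iff (hν : IsPurchaseDistribution ν) {K : ℝ} (hK : 0 ≤ K) :
    competitiveRatio ν ≤ ENNReal.ofReal (1 + K) ↔ ∀ x ∈ Ioc (0 : ℝ) 1,
      cdf ν x ≤ K * x + ∫ s in (0 : ℝ)..x, cdf ν s := by
  simp only [competitiveRatio, iSup_le_iff]
  refine forall₂_congr fun x hx => ?_
  rw [hν.expectedRatio_eq hx.1, ENNReal.ofReal_le_ofReal_iff (by linarith), add_le_add_iff_left,
    div_le_iff₀ hx.1]
  constructor <;> intro h <;> linarith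

end IsPurchaseDistribution

lemma IsFeasible.isSubsolution_cdf {γ : ℕ} (hγ : 2 ≤ γ) {δ K : ℝ} (hδ : 0 < δ) (hK : 0 ≤ K)
    {ν : Measure ℝ} (hν : IsFeasible γ δ ν) (h : competitiveRatio ν ≤ ENNReal.ofReal (1 + K)) :
    IsSubsolution γ δ K (cdf ν) where
  mono := monotone_cdf ν
  nonneg := cdf_nonneg ν
  le_bound x := by
    have hγ' : (2 : ℝ) ≤ γ := by exact_mod_cast hγ
    rw [← hν.1.cdf_unitClamp x]
    refine le_min (cdf_le_one ν _) ?_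
    rcases (unitClamp_nonneg x).eq_or_lt with h0 | h0
    · rw [← h0, hν.1.cdf_of_nonpos le_rfl]
      refine le_min (by simp) (add_nonneg hδ.le (cdf_nonneg ν _))
    · exact le_min ((hν.1.competitiveRatio_le_iff hK).1 h _ ⟨h0, unitClamp_le_one x⟩)
        ((hν.1.tail_iff (by linarith) hδ h0).1 (hν.2 _ ⟨h0, unitClamp_le_one x⟩))

/-! ### Optimality and uniqueness -/

section
variable {γ : ℕ} (hγ : 2 ≤ γ) {δ : ℝ} (hδ : 0 < δ)
include hγ hδ

lemma competitiveRatio_optStieltjes :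
    competitiveRatio (optStieltjes hγ hδ).measure = ENNReal.ofReal (1 + optExcess γ δ) := by
  have hν := isPurchaseDistribution_optStieltjes hγ hδ
  have hK := optExcess_pos hγ hδ
  refine le_antisymm ((hν.competitiveRatio_le_iff hK.le).2 fun x hx => ?_) ?_
  · rw [cdf_optStieltjes]
    exact (isSubsolution_optCdf hγ hδ).le_ratio hx.1.le hx.2
  · have h : expectedRatio (optStieltjes hγ hδ).measure 1 =
        ENNReal.ofReal (1 + optExcess γ δ) := by
      rw [hν.expectedRatio_eq one_pos, cdf_optStieltjes]
      change ENNReal.ofReal (1 + (optCdf γ δ 1 - ∫ s in (0 : ℝ)..1, optCdf γ δ s) / 1) = _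
      have := optExcess_add_integral hγ hδ
      rw [optCdf_one hγ hδ, div_one]
      congr 1
      linarith
    rw [← h]
    exact le_iSup₂_of_le 1 ⟨one_pos, le_rfl⟩ le_rfl

lemma isFeasible_optStieltjes : IsFeasible γ δ (optStieltjes hγ hδ).measure := by
  have hγ' : (2 : ℝ) ≤ γ := by exact_mod_cast hγ
  have hν := isPurchaseDistribution_optStieltjes hγ hδ
  refine ⟨hν, fun x hx => (hν.tail_iff (by linarith) hδ hx.1).2 ?_⟩
  rw [cdf_optStieltjes]
  change optCdf γ δ x ≤ δ + optCdf γ δ (γ * x - 1)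
  rw [optCdf_eq_min hγ hδ hx.1.le hx.2]
  exact min_le_right _ _

lemma cdf_le_optCdf {ν : Measure ℝ} (hν : IsFeasible γ δ ν)
    (h : competitiveRatio ν ≤ ENNReal.ofReal (1 + optExcess γ δ)) (x : ℝ) :
    cdf ν x ≤ optCdf γ δ x :=
  (hν.isSubsolution_cdf hγ hδ (optExcess_pos hγ hδ).le h).le_max x

lemma isOptimalSolution_optStieltjes :
    IsOptimalSolution γ δ (optStieltjes hγ hδ).measure := by
  refine ⟨isFeasible_optStieltjes hγ hδ, fun ν hν => ?_⟩
  rw [competitiveRatio_optStieltjes]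
  rcases le_total (ENNReal.ofReal (1 + optExcess γ δ)) (competitiveRatio ν) with h | h
  · exact h
  -- A competitor at least as good lies below `F`, so its ratio at `x = 1`, which is `2 - ∫₀¹ cdf`,
  -- is no smaller.
  · have hle := intervalIntegral.integral_mono_on zero_le_one
      (monotone_cdf ν).intervalIntegrable
      (isSubsolution_optCdf hγ hδ).mono.intervalIntegrable
      (μ := volume) fun x _ => cdf_le_optCdf hγ hδ hν h x
    refine le_trans ?_ (le_iSup₂_of_le 1 ⟨one_pos, le_rfl⟩ le_rfl :
      expectedRatio ν 1 ≤ competitiveRatio ν)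
    rw [hν.1.expectedRatio_eq one_pos, hν.1.cdf_of_one_le le_rfl]
    refine ENNReal.ofReal_le_ofReal ?_
    have := optExcess_add_integral hγ hδ
    linarith

lemma IsOptimalSolution.eq_optStieltjes {ν : Measure ℝ} (hν : IsOptimalSolution γ δ ν) :
    ν = (optStieltjes hγ hδ).measure := by
  have hp := hν.1.1.isProbabilityMeasure
  have hF := isSubsolution_optCdf hγ hδ
  have hratio : competitiveRatio ν ≤ ENNReal.ofReal (1 + optExcess γ δ) :=
    competitiveRatio_optStieltjes hγ hδ ▸ hν.2 _ (isFeasible_optStieltjes hγ hδ)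
  have hle := cdf_le_optCdf hγ hδ hν.1 hratio
  have hi : ∀ a b, IntervalIntegrable (fun s => optCdf γ δ s - cdf ν s) volume a b :=
    fun a b => hF.mono.intervalIntegrable.sub (monotone_cdf ν).intervalIntegrable
  have hint : ∫ s in (0 : ℝ)..1, (optCdf γ δ s - cdf ν s) ≤ 0 := by
    have h1 := (hν.1.1.competitiveRatio_le_iff (optExcess_pos hγ hδ).le).1 hratio 1
      ⟨one_pos, le_rfl⟩
    rw [hν.1.1.cdf_of_one_le le_rfl] at h1
    rw [intervalIntegral.integral_sub hF.mono.intervalIntegrable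
      (monotone_cdf ν).intervalIntegrable]
    have := optExcess_add_integral hγ hδ
    linarith
  -- `F x > cdf ν y` would make `F - cdf ν` bounded below by a positive constant on `[x, y]`.
  -- Letting `y` decrease to `x` then uses right continuity.
  have key : ∀ x y, 0 ≤ x → x < y → y ≤ 1 → optCdf γ δ x ≤ cdf ν y := by
    intro x y hx hxy hy
    have h1 : ∫ s in x..y, (optCdf γ δ s - cdf ν s) ≤ 0 :=
      (intervalIntegral.integral_mono_interval hx hxy.le hy
        (Eventually.of_forall fun s => sub_nonneg.2 (hle s)) (hi 0 1)).trans hint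
    have h2 := intervalIntegral.integral_mono_on hxy.le
      (intervalIntegrable_const (c := optCdf γ δ x - cdf ν y)) (hi x y)
      fun s hs => sub_le_sub (hF.mono hs.1) (monotone_cdf ν hs.2)
    rw [intervalIntegral.integral_const, smul_eq_mul] at h2
    have h3 : 0 < y - x := sub_pos.2 hxy
    by_contra! hlt
    nlinarith
  rw [← measure_cdf ν]
  congr 1
  ext x
  change cdf ν x = optCdf γ δ x
  rcases lt_or_ge x 0 with h0 | h0
  · rw [hν.1.1.cdf_of_nonpos h0.le, optCdf_of_nonpos hγ hδ h0.le]
  rcases lt_or_ge x 1 with h1 | h1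
  · refine le_antisymm (hle x) (ge_of_tendsto
      (((cdf ν).right_continuous x).mono Ioi_subset_Ici_self) ?_)
    filter_upwards [Ioc_mem_nhdsGT h1] with y hy using key x y h0 hy.1 hy.2
  · rw [hν.1.1.cdf_of_one_le h1, optCdf_of_one_le hγ hδ h1]

end

theorem mainTheorem5 (γ : ℕ) (hγ : 2 ≤ γ) (δ : ℝ) (hδ : 0 < δ) :
    ∃ f : ℝ → ℝ, Measurable f ∧ (∀ t, 0 ≤ f t) ∧
      -- the optimal solution exists, is unique among all purchase distributions, and has density f
      IsOptimalSolution γ δ (densityLaw f) ∧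
      (∀ ν : Measure ℝ, IsOptimalSolution γ δ ν → ν = densityLaw f) ∧
      -- its structure on the intervals P_j = (ℓ_j, ℓ_{j+1}]
      (∃ c that : ℕ → ℝ, ∀ j : ℕ, (j : ℝ) < 1 / (2 * (γ : ℝ) * δ) - 1 →
        0 < c j ∧ 0 < that j ∧ that j < leftEnd γ (j + 1) - leftEnd γ j ∧
        that j = Real.log (1 + δ / ((competitiveRatio (densityLaw f)).toReal - 1)) / (γ : ℝ) ^ j ∧
        (∀ t ∈ Ioc (leftEnd γ j) (leftEnd γ j + that j),
          f t = c j * Real.exp ((γ : ℝ) ^ j * t)) ∧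
        (∀ t ∈ Ioc (leftEnd γ j + that j) (leftEnd γ (j + 1)), f t = 0)) ∧
      -- hence it is not monotone
      (0 < 1 / (2 * (γ : ℝ) * δ) - 1 →
        ¬ MonotoneOn f (Ioc 0 1) ∧ ¬ AntitoneOn f (Ioc 0 1)) := by
  have hγ' : (2 : ℝ) ≤ γ := by exact_mod_cast hγ
  have hK := optExcess_pos hγ hδ
  have hlaw := densityLaw_optDensity hγ hδ
  have hpos : 0 < 2 * (γ : ℝ) * δ := by positivity
  have hτ := supportLength_pos hγ hδ
  have hgood : ∀ j : ℕ, (j : ℝ) < 1 / (2 * (γ : ℝ) * δ) - 1 →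
      ((j : ℝ) + 1) * (2 * γ * δ) < 1 := fun j hj => by
    rwa [lt_sub_iff_add_lt, lt_div_iff₀ hpos] at hj
  have hsmall : ∀ j : ℕ, (j : ℝ) < 1 / (2 * (γ : ℝ) * δ) - 1 → 2 * γ * δ < 1 := fun j hj => by
    have := hgood j hj
    have hj0 : (0 : ℝ) ≤ j := j.cast_nonneg
    nlinarith
  refine ⟨optDensity γ δ, measurable_optDensity, optDensity_nonneg hγ hδ,
    hlaw ▸ isOptimalSolution_optStieltjes hγ hδ,
    fun ν hν => hlaw ▸ hν.eq_optStieltjes hγ hδ,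
    ⟨fun j => optExcess γ δ * (γ : ℝ) ^ j * Real.exp (-((γ : ℝ) ^ j * leftEnd γ j)),
      fun j => supportLength γ δ / (γ : ℝ) ^ j, fun j hj => ⟨by positivity, by positivity,
        supportLength_div_lt hγ hδ (hsmall j hj), ?_, fun t ht =>
        optDensity_on_support hγ hδ (hgood j hj) (supportLength_div_lt hγ hδ (hsmall j hj)) ht,
        fun t ht => optDensity_off_support hγ hδ (hgood j hj) ht⟩⟩, fun h0 => ?_⟩
  · rw [hlaw, competitiveRatio_optStieltjes, ENNReal.toReal_ofReal (by linarith),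
      add_sub_cancel_left, supportLength]
  · have h0' : ((0 : ℕ) : ℝ) < 1 / (2 * (γ : ℝ) * δ) - 1 := by simpa using h0
    have hlen := supportLength_div_lt hγ hδ (j := 0) (hsmall 0 h0')
    have hon := fun t => optDensity_on_support hγ hδ (hgood 0 h0') hlen (t := t)
    have hoff := optDensity_off_support hγ hδ (hgood 0 h0') (t := leftEnd γ 1)
    have hl1 := leftEnd_lt_one hγ 1
    simp only [zero_add, leftEnd_zero, pow_zero, div_one, sub_zero, mem_Ioc, mul_one, one_mul,
      mul_zero, neg_zero, Real.exp_zero, le_refl, and_true] at hlen hon hoff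
    have hoff := hoff hlen
    have hend := hon (supportLength γ δ) ⟨hτ, le_rfl⟩
    have hmid := hon (supportLength γ δ / 2) ⟨by linarith, by linarith⟩
    -- On `P_0` the density is strictly increasing and positive up to `supportLength`, yet vanishes
    -- at `ℓ_1`.
    constructor
    · intro hmono
      have h := hmono ⟨hτ, by linarith⟩ ⟨hτ.trans hlen, hl1.le⟩ hlen.le
      rw [hoff, hend] at h
      have := mul_pos hK (Real.exp_pos (supportLength γ δ))
      linarith
    · intro hanti
      have h := hanti (a := supportLength γ δ / 2) ⟨by linarith, by linarith⟩
        ⟨hτ, by linarith⟩ (by linarith)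
      rw [hend, hmid] at h
      have := Real.exp_le_exp.1 (le_of_mul_le_mul_left h hK)
      linarith
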